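/- **Theorem 3.1 (Convergence of DNWR for multiple subdomains, 1D wave equation).** Let $c>0$, $T>0$, $m\ge 0$ an integer and $0=x_0<x_1<\dots<x_{2m+1}=L$. Put $\Omega_i=(x_{i-1},x_i)$ and $h_{\min}=\min_{1\le i\le 2m+1}(x_i-x_{i-1})$. Consider the error equations of the Dirichlet–Neumann waveform relaxation (DNWR) algorithm on the time window $(0,T)$. Given arbitrary initial interface guesses $g_i^0\in L^1(0,T)$, $1\le i\le 2m$, and with $g_0^n=g_{2m+1}^n=0$ for all $n\ge 0$, in iteration $n=1,2,\dots$ every $u_i^n$, $1\le i\le 2m+1$, solves $$\partial_{tt}u_i^n-c^2\partial_{xx}u_i^n=0\ \text{ in }\Omega_i\times(0,T),\qquad u_i^n(\cdot,0)=0,\quad \partial_tu_i^n(\cdot,0)=0,$$ with the boundary conditions $$u_{m+1}^n(x_m,t)=g_m^{n-1}(t),\qquad u_{m+1}^n(x_{m+1},t)=g_{m+1}^{n-1}(t)$$ in the middle subdomain, and then, going outwards, for $m\ge i\ge1$ and $m+2\le j\le 2m+1$, $$u_i^n(x_{i-1},t)=g_{i-1}^{n-1}(t),\quad \partial_xu_i^n(x_i,t)=w_i^n(t),\qquad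 -\partial_xu_j^n(x_{j-1},t)=w_{j-1}^n(t),\quad u_j^n(x_j,t)=g_j^{n-1}(t),$$ where $$g_i^n(t)=\theta u_i^n(x_i,t)+(1-\theta)g_i^{n-1}(t),\quad w_i^n(t)=\partial_xu_{i+1}^n(x_i,t),\qquad 1\le i\le m,$$ $$g_j^n(t)=\theta u_{j+1}^n(x_j,t)+(1-\theta)g_j^{n-1}(t),\quad w_j^n(t)=-\partial_xu_j^n(x_j,t),\qquad m+1\le j\le 2m.$$ Solutions are understood in the very weak sense: on $(a,b)\times(0,T)$ with $a=x_{i-1}$, $b=x_i$, the function $u=u_i^n$ is in $L^1$, its Dirichlet traces $u(a,\cdot),u(b,\cdot)$ and the time primitives $P_a,P_b$ of its Neumann traces ($P_a(t)=\int_0^t\partial_xu(a,\tau)\,d\tau$, likewise $P_b$) are in $L^1(0,T)$, and $$\int_0^T\!\!\int_a^b u\,(\varphi_{tt}-c^2\varphi_{xx})\,dx\,dt=c^2\int_0^T\big(u(a,t)\varphi_x(a,t)-u(b,t)\varphi_x(b,t)+P_a(t)\varphi_t(a,t)-P_b(t)\varphi_t(b,t)\big)\,dt$$ for all smooth $\varphi$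 that vanish on $[a,b]\times[T',\infty)$ for some $T'<T$. Equalities of traces hold a.e. on $(0,T)$, those of Neumann traces being equalities of the time primitives. Let $\theta=1/2$ and let $k\ge1$ be an integer with $T/k\le h_{\min}/c$. Then the algorithm converges in at most $k+1$ iterations: $g_i^n=0$ a.e. on $(0,T)$ for all $n\ge k$ and $1\le i\le 2m$, and $u_i^n=0$ a.e. on $\Omega_i\times(0,T)$ for all $n\ge k+1$ and $1\le i\le 2m+1$. -/

import Mathlib

open MeasureTheory Set
open scoped ContDiff

namespace DNWR

/-- Partial derivative in the space variable of a function of `(x, t)`. -/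
noncomputable def dx (φ : ℝ × ℝ → ℝ) (z : ℝ × ℝ) : ℝ := deriv (fun y => φ (y, z.2)) z.1

/-- Partial derivative in the time variable of a function of `(x, t)`. -/
noncomputable def dt (φ : ℝ × ℝ → ℝ) (z : ℝ × ℝ) : ℝ := deriv (fun s => φ (z.1, s)) z.2

/-- Equality almost everywhere on the time window `(0, T)`. -/
def EqOnWindow (T : ℝ) (f g : ℝ → ℝ) : Prop := f =ᵐ[volume.restrict (Ioo 0 T)] g

/-- The space-time cylinder `(a, b) × (0, T)`. -/
def cylinder (a b T : ℝ) : Set (ℝ × ℝ) := Ioo a b ×ˢ Ioo 0 T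

/-- Test functions on `[a, b] × [0, T)`: smooth, vanishing near the final time `t = T`; there is no
condition at `t = 0`, at `x = a` or at `x = b`. -/
def IsTest (a b T : ℝ) (φ : ℝ × ℝ → ℝ) : Prop :=
  ContDiff ℝ ∞ φ ∧ ∃ T' < T, ∀ x ∈ Icc a b, ∀ t, T' ≤ t → φ (x, t) = 0

/-- A function on a cylinder `(a, b) × (0, T)` together with its Dirichlet and Neumann traces.

* `left`, `right` stand for `u(a, ·)` and `u(b, ·)`;
* `NLeft`, `NRight` stand for the Neumann traces `∂ₓu(a, ·)` and `∂ₓu(b, ·)`. Since these are in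
  general only distributions in time, each is recorded by its time primitive:
  `NLeft t = ∫₀ᵗ ∂ₓu(a, τ) dτ`, `NRight t = ∫₀ᵗ ∂ₓu(b, τ) dτ`. -/
structure TracedFunction where
  u : ℝ × ℝ → ℝ
  left : ℝ → ℝ
  right : ℝ → ℝ
  NLeft : ℝ → ℝ
  NRight : ℝ → ℝ

/-- `S.u` is a (very weak, `L¹`) solution on `(a, b) × (0, T)` of
`∂ₜₜu - c² ∂ₓₓu = 0`, `u(·, 0) = 0`, `∂ₜu(·, 0) = 0`, whose Dirichlet and Neumann traces at
`x = a` and `x = b` are the ones recorded in `S`.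

The identity is obtained from `∬ (∂ₜₜu - c² ∂ₓₓu) φ = 0` by two integrations by parts in each
variable. The terms at `t = 0` drop because of the zero initial data and those at `t = T` because
`φ` vanishes there. The Neumann terms `∫ ∂ₓu φ dt` are integrated by parts once more in time, so
that the time primitives of `∂ₓu` appear. As `φ` is free on the rest of the boundary, the identity
expresses the equation, both initial conditions and all four traces. Classical solutions and
finite energy solutions satisfy it. -/
structure IsWaveSolution (c a b T : ℝ) (S : TracedFunction) : Prop where
  integrable_u : IntegrableOn S.u (cylinder a b T)
  integrable_left : IntegrableOn S.left (Ioo 0 T)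
  integrable_right : IntegrableOn S.right (Ioo 0 T)
  integrable_NLeft : IntegrableOn S.NLeft (Ioo 0 T)
  integrable_NRight : IntegrableOn S.NRight (Ioo 0 T)
  weak : ∀ φ : ℝ × ℝ → ℝ, IsTest a b T φ →
    ∫ z in cylinder a b T, S.u z * (dt (dt φ) z - c ^ 2 * dx (dx φ) z) =
      c ^ 2 * (∫ t in Ioo 0 T, (S.left t * dx φ (a, t) - S.right t * dx φ (b, t))) +
      c ^ 2 * (∫ t in Ioo 0 T, (S.NLeft t * dt φ (a, t) - S.NRight t * dt φ (b, t)))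

/-- `0 = x₀ < x₁ < ⋯ < x_{2m+1} = L`: a splitting of `(0, L)` into the `2m + 1` subdomains
`Ωᵢ = (x_{i-1}, xᵢ)`, `1 ≤ i ≤ 2m + 1`. -/
def IsPartition (L : ℝ) (m : ℕ) (x : ℕ → ℝ) : Prop :=
  x 0 = 0 ∧ x (2 * m + 1) = L ∧ ∀ i ∈ Finset.Icc 1 (2 * m + 1), x (i - 1) < x i

/-- The smallest subdomain length `h_min = min_{1 ≤ i ≤ 2m+1} (xᵢ - x_{i-1})`. -/
noncomputable def hmin (m : ℕ) (x : ℕ → ℝ) : ℝ :=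
  (Finset.Icc 1 (2 * m + 1)).inf' (Finset.nonempty_Icc.mpr (by omega)) fun i => x i - x (i - 1)

/-- The (error equations of the) Dirichlet–Neumann waveform relaxation algorithm for the 1D wave
equation with wave speed `c` on the time window `(0, T)`, with `2m + 1` subdomains in the
arrangement that starts with a Dirichlet solve in the middle subdomain `Ω_{m+1}` and proceeds
outwards with mixed solves.

* `g n i` is the Dirichlet interface function `gᵢⁿ` at `xᵢ`, and `g 0 i` the initial guess;
* `S n i` is the solution `uᵢⁿ` on `Ωᵢ` in iteration `n ≥ 1`, with its traces;
* `W n i` is the time primitive of the Neumann interface function `wᵢⁿ` at `xᵢ`. -/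
structure IsDNWR (m : ℕ) (x : ℕ → ℝ) (c T θ : ℝ) (g : ℕ → ℕ → ℝ → ℝ) (W : ℕ → ℕ → ℝ → ℝ)
    (S : ℕ → ℕ → TracedFunction) : Prop where
  /-- the initial guesses, arbitrary integrable functions -/
  init : ∀ i, 1 ≤ i → i ≤ 2 * m → IntegrableOn (g 0 i) (Ioo 0 T)
  /-- zero error at the physical boundary -/
  bdry_left : ∀ n, EqOnWindow T (g n 0) 0
  bdry_right : ∀ n, EqOnWindow T (g n (2 * m + 1)) 0
  /-- the wave equation with zero initial data in every subdomain -/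
  wave : ∀ n i, 1 ≤ n → 1 ≤ i → i ≤ 2 * m + 1 →
    IsWaveSolution c (x (i - 1)) (x i) T (S n i)
  /-- Dirichlet conditions in the middle subdomain -/
  mid_left : ∀ n, 1 ≤ n → EqOnWindow T (S n (m + 1)).left (g (n - 1) m)
  mid_right : ∀ n, 1 ≤ n → EqOnWindow T (S n (m + 1)).right (g (n - 1) (m + 1))
  /-- `uᵢⁿ(x_{i-1}, ·) = g_{i-1}^{n-1}` and `∂ₓuᵢⁿ(xᵢ, ·) = wᵢⁿ` for `1 ≤ i ≤ m` -/
  lower_dirichlet : ∀ n i, 1 ≤ n → 1 ≤ i → i ≤ m →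
    EqOnWindow T (S n i).left (g (n - 1) (i - 1))
  lower_neumann : ∀ n i, 1 ≤ n → 1 ≤ i → i ≤ m →
    EqOnWindow T (S n i).NRight (W n i)
  /-- `-∂ₓuⱼⁿ(x_{j-1}, ·) = w_{j-1}ⁿ` and `uⱼⁿ(xⱼ, ·) = gⱼ^{n-1}` for `m + 2 ≤ j ≤ 2m + 1` -/
  upper_neumann : ∀ n j, 1 ≤ n → m + 2 ≤ j → j ≤ 2 * m + 1 →
    EqOnWindow T (-(S n j).NLeft) (W n (j - 1))
  upper_dirichlet : ∀ n j, 1 ≤ n → m + 2 ≤ j → j ≤ 2 * m + 1 →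
    EqOnWindow T (S n j).right (g (n - 1) j)
  /-- `gᵢⁿ = θ uᵢⁿ(xᵢ, ·) + (1 - θ) gᵢ^{n-1}` and `wᵢⁿ = ∂ₓu_{i+1}ⁿ(xᵢ, ·)` for `1 ≤ i ≤ m` -/
  lower_update : ∀ n i, 1 ≤ n → 1 ≤ i → i ≤ m →
    EqOnWindow T (g n i) (fun t => θ * (S n i).right t + (1 - θ) * g (n - 1) i t)
  lower_flux : ∀ n i, 1 ≤ n → 1 ≤ i → i ≤ m →
    EqOnWindow T (W n i) (S n (i + 1)).NLeft
  /-- `gⱼⁿ = θ u_{j+1}ⁿ(xⱼ, ·) + (1 - θ) gⱼ^{n-1}` and `wⱼⁿ = -∂ₓuⱼⁿ(xⱼ, ·)` for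
  `m + 1 ≤ j ≤ 2m` -/
  upper_update : ∀ n j, 1 ≤ n → m + 1 ≤ j → j ≤ 2 * m →
    EqOnWindow T (g n j) (fun t => θ * (S n (j + 1)).left t + (1 - θ) * g (n - 1) j t)
  upper_flux : ∀ n j, 1 ≤ n → m + 1 ≤ j → j ≤ 2 * m →
    EqOnWindow T (W n j) (-(S n j).NRight)

end DNWR

/-!
By d'Alembert's formula a solution of the wave equation on `(a, b)` with zero initial data is a sum
of a right-going and a left-going wave, and with the time primitives `P` of the Neumann traces their
boundary values are, up to the factor `2`, the combinations `u - c P` and `u + c P`. At each end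
one of the two arrives and the other one leaves, and what arrives left the opposite end one crossing
time `(b - a) / c` earlier. In the very weak setting this is the weak formulation tested with plane
waves `G(t ± x / c)` (`IsWaveSolution.integral_planeWave`), which turns into a statement on a.e.
vanishing by the fundamental lemma of the calculus of variations
(`IsWaveSolution.inRight_vanishesBefore`, `IsWaveSolution.inLeft_vanishesBefore`).

If the interface functions of an iteration vanish before the time `s`, then going outwards from the
middle subdomain every solution of the next iteration has homogeneous boundary conditions before
`s`. Both ends then only reflect what arrives, so all traces vanish before `s`, and the arriving
waves vanish even before `s + h_min / c` (`IsDNWR.subdomain_vanishesBefore`). For `θ = 1/2` the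
leaving waves cancel in the update, and the new interface function is a sum of two arriving waves
(`IsDNWR.interface_eq_incoming`). So each iteration gains the time `h_min / c`, and after `k`
iterations the interface functions vanish on the whole window.

In the iteration after that all traces are zero, and such a solution is zero
(`IsWaveSolution.ae_eq_zero`): as no boundary terms are left, it suffices that every smooth source
compactly supported in the cylinder is `∂ₜₜφ - c² ∂ₓₓφ` for a test function `φ`. Since the wave
operator factors into the derivatives along the two characteristic directions, integrating the
source along both of them gives such a `φ` (`exists_isTest_wave_operator_eq`).
-/

namespace DNWR

/-! ### Solving the wave equation backwards in time -/

theorem exists_lt_forall_mem_lt {K : Set ℝ} (hK : IsCompact K) {T : ℝ} (hKT : K ⊆ Iio T) :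
    ∃ T' < T, ∀ t ∈ K, t < T' := by
  rcases K.eq_empty_or_nonempty with rfl | hne
  · exact ⟨T - 1, by linarith, by simp⟩
  · obtain ⟨M, hM, hmax⟩ := hK.exists_isGreatest hne
    obtain ⟨T', h1, h2⟩ := exists_between (mem_Iio.1 (hKT hM))
    exact ⟨T', h2, fun t ht => (hmax ht).trans_lt h1⟩

/-- The integral `∫₀ᴿ f(z + p e) dp` of `f` over the segment of parameter length `R` that starts at
`z` in the direction `e`. For `f` vanishing beyond the far end of the segments, `-rayIntegral R e f`
is a right inverse of the derivative in the direction `e`. -/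
noncomputable def rayIntegral (R : ℝ) (e : ℝ × ℝ) (f : ℝ × ℝ → ℝ) (z : ℝ × ℝ) : ℝ :=
  ∫ p in (0 : ℝ)..R, f (z + p • e)

theorem contDiff_rayIntegral {R : ℝ} (hR : 0 < R) (e : ℝ × ℝ) {f : ℝ × ℝ → ℝ}
    (hf : ContDiff ℝ ∞ f) : ContDiff ℝ ∞ (rayIntegral R e f) := by
  -- A cutoff `χ`, equal to `1` on the range of integration, turns the integral into a convolution
  -- with a smooth compactly supported function depending on the parameter `z`.
  let χ : ContDiffBump (0 : ℝ) := ⟨R, R + 1, hR, by linarith⟩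
  let G : ℝ × ℝ → ℝ → ℝ := fun z p => χ p * f (z - p • e)
  have hloc : LocallyIntegrable (indicator (Ioc 0 R) fun _ : ℝ => (1 : ℝ)) volume :=
    ((integrable_indicator_iff measurableSet_Ioc).2
      (integrableOn_const (by simp) (by simp))).locallyIntegrable
  have hconv := contDiffOn_convolution_right_with_param_comp (n := ⊤) (μ := volume) (P := ℝ × ℝ)
    (ContinuousLinearMap.mul ℝ ℝ) (s := univ) (v := fun _ => (0 : ℝ)) contDiffOn_const
    (g := G) (k := tsupport χ) isOpen_univ χ.hasCompactSupport
    (fun z p _ hp => by simp [G, image_eq_zero_of_notMem_tsupport hp]) hloc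
    (by
      apply ContDiff.contDiffOn
      have : ContDiff ℝ ∞ fun q : (ℝ × ℝ) × ℝ => χ q.2 * f (q.1 - q.2 • e) :=
        (χ.contDiff.comp contDiff_snd).mul
          (hf.comp (contDiff_fst.sub (contDiff_snd.smul contDiff_const)))
      exact this)
  rw [contDiffOn_univ] at hconv
  convert hconv using 1
  ext z
  rw [convolution, rayIntegral, intervalIntegral.integral_of_le hR.le,
    ← integral_indicator measurableSet_Ioc]
  congr 1 with p
  by_cases hp : p ∈ Ioc 0 R
  · have h1 : χ (0 - p) = 1 := χ.one_of_mem_closedBall (by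
      simpa [χ, abs_of_pos hp.1] using hp.2)
    simp [hp, G] at *
    simp [h1]
  · simp [hp]

theorem fderiv_rayIntegral_apply_self {R : ℝ} (hR : 0 < R) (e : ℝ × ℝ) {f : ℝ × ℝ → ℝ}
    (hf : ContDiff ℝ ∞ f) (z : ℝ × ℝ) :
    fderiv ℝ (rayIntegral R e f) z e = f (z + R • e) - f z := by
  have hcont : Continuous fun p : ℝ => f (z + p • e) := by
    have := hf.continuous
    fun_prop
  -- Along the line through `z` in the direction `e`, only the limits of integration move.
  have hline : ∀ s : ℝ, rayIntegral R e f (z + s • e) =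
      (∫ p in (0 : ℝ)..(R + s), f (z + p • e)) - ∫ p in (0 : ℝ)..s, f (z + p • e) := by
    intro s
    rw [intervalIntegral.integral_interval_sub_left (hcont.intervalIntegrable _ _)
      (hcont.intervalIntegrable _ _), rayIntegral]
    have := intervalIntegral.integral_comp_add_right (a := 0) (b := R)
      (fun p : ℝ => f (z + p • e)) s
    simp only [zero_add] at this
    rw [← this]
    congr 1 with p
    rw [add_smul]
    congr 1
    abel
  have h1 : HasDerivAt (fun s : ℝ => rayIntegral R e f (z + s • e)) (f (z + R • e) - f z) 0 := by
    rw [funext hline]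
    have ha : HasDerivAt (fun r => ∫ p in (0 : ℝ)..r, f (z + p • e)) (f (z + R • e)) (R + 0) := by
      have := intervalIntegral.integral_hasDerivAt_right (hcont.intervalIntegrable 0 (R + 0))
        (hcont.stronglyMeasurableAtFilter _ _) hcont.continuousAt
      simpa using this
    have hb : HasDerivAt (fun r => ∫ p in (0 : ℝ)..r, f (z + p • e)) (f z) 0 := by
      have := intervalIntegral.integral_hasDerivAt_right (hcont.intervalIntegrable 0 0)
        (hcont.stronglyMeasurableAtFilter _ _) hcont.continuousAt
      simpa using this
    exact (ha.comp_const_add R 0).sub hb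
  have h2 : HasDerivAt (fun s : ℝ => rayIntegral R e f (z + s • e))
      (fderiv ℝ (rayIntegral R e f) z e) 0 := by
    have hd : HasFDerivAt (rayIntegral R e f) (fderiv ℝ (rayIntegral R e f) z)
        (z + (0 : ℝ) • e) := by
      simpa using ((contDiff_rayIntegral hR e hf).differentiable (by simp) z).hasFDerivAt
    have hl : HasDerivAt (fun s : ℝ => z + s • e) e 0 := by
      simpa using ((hasDerivAt_id (0 : ℝ)).smul_const e).const_add z
    exact hd.comp_hasDerivAt (0 : ℝ) hl
  exact h2.unique h1

theorem rayIntegral_eq_zero {R T' : ℝ} (hR : 0 ≤ R) {e : ℝ × ℝ} (he : 0 ≤ e.2) {f : ℝ × ℝ → ℝ}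
    (hf : ∀ z : ℝ × ℝ, T' ≤ z.2 → f z = 0) {z : ℝ × ℝ} (hz : T' ≤ z.2) :
    rayIntegral R e f z = 0 := by
  rw [rayIntegral, intervalIntegral.integral_congr (g := fun _ => 0)]
  · simp
  · intro p hp
    rw [uIcc_of_le hR] at hp
    apply hf
    have := mul_nonneg hp.1 he
    simp only [Prod.snd_add, Prod.smul_snd, smul_eq_mul]
    linarith

theorem dx_eq_fderiv {φ : ℝ × ℝ → ℝ} (hφ : Differentiable ℝ φ) :
    dx φ = fun z => fderiv ℝ φ z (1, 0) := by
  ext z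
  have h : HasDerivAt (fun y : ℝ => (y, z.2)) ((1 : ℝ), (0 : ℝ)) z.1 :=
    (hasDerivAt_id z.1).prodMk (hasDerivAt_const z.1 z.2)
  exact ((hφ z).hasFDerivAt.comp_hasDerivAt z.1 h).deriv

theorem dt_eq_fderiv {φ : ℝ × ℝ → ℝ} (hφ : Differentiable ℝ φ) :
    dt φ = fun z => fderiv ℝ φ z (0, 1) := by
  ext z
  have h : HasDerivAt (fun s : ℝ => (z.1, s)) ((0 : ℝ), (1 : ℝ)) z.2 :=
    (hasDerivAt_const z.2 z.1).prodMk (hasDerivAt_id z.2)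
  exact ((hφ z).hasFDerivAt.comp_hasDerivAt z.2 h).deriv

/-- The wave operator factors as `∂ₜₜ - c² ∂ₓₓ = (∂ₜ - c ∂ₓ)(∂ₜ + c ∂ₓ)`. -/
theorem wave_operator_eq_fderiv (c : ℝ) {φ : ℝ × ℝ → ℝ} (hφ : ContDiff ℝ ∞ φ) (z : ℝ × ℝ) :
    dt (dt φ) z - c ^ 2 * dx (dx φ) z = fderiv ℝ (fun w => fderiv ℝ φ w (c, 1)) z (-c, 1) := by
  have hd : Differentiable ℝ φ := hφ.differentiable (by simp)
  have h1 : ContDiff ℝ ∞ (fderiv ℝ φ) := hφ.fderiv_right (by simp)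
  have hd1 : Differentiable ℝ (fderiv ℝ φ) := h1.differentiable (by simp)
  have hdv : ∀ v : ℝ × ℝ, Differentiable ℝ fun w => fderiv ℝ φ w v := fun v => by fun_prop
  have happ : ∀ v u : ℝ × ℝ,
      fderiv ℝ (fun w => fderiv ℝ φ w v) z u = fderiv ℝ (fderiv ℝ φ) z u v := by
    intro v u
    rw [fderiv_clm_apply (hd1 z) (by fun_prop)]
    simp
  have hsymm : IsSymmSndFDerivAt ℝ φ z :=
    (contDiff_infty.1 hφ 2).contDiffAt.isSymmSndFDerivAt (by simp)
  rw [dt_eq_fderiv hd, dx_eq_fderiv hd, dt_eq_fderiv (hdv _), dx_eq_fderiv (hdv _)]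
  simp only [happ]
  have hs := hsymm (1, 0) (0, 1)
  have e1 : ((c, 1) : ℝ × ℝ) = c • (1, 0) + (0, 1) := by simp
  have e2 : ((-c, 1) : ℝ × ℝ) = (-c) • (1, 0) + (0, 1) := by simp
  rw [e1, e2]
  simp only [map_add, map_smul, _root_.add_apply, _root_.smul_apply,
    smul_eq_mul]
  rw [hs]
  ring

/-- For a source that vanishes near the final time there is a smooth test function `φ` with
`∂ₜₜφ - c² ∂ₓₓφ = f` at positive times: integrate `f` twice, along both characteristic directions,
towards the future. -/
theorem exists_isTest_wave_operator_eq (c a b : ℝ) {T T' : ℝ} (hT : 0 < T) (hT' : T' < T)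
    {f : ℝ × ℝ → ℝ} (hf : ContDiff ℝ ∞ f) (hfT : ∀ z : ℝ × ℝ, T' ≤ z.2 → f z = 0) :
    ∃ φ, IsTest a b T φ ∧ ∀ z : ℝ × ℝ, 0 < z.2 → dt (dt φ) z - c ^ 2 * dx (dx φ) z = f z := by
  set G := rayIntegral T (-c, 1) f with hG
  have hGs : ContDiff ℝ ∞ G := contDiff_rayIntegral hT _ hf
  have hGT : ∀ z : ℝ × ℝ, T' ≤ z.2 → G z = 0 := fun z hz =>
    rayIntegral_eq_zero hT.le (by simp) hfT hz
  have hφs : ContDiff ℝ ∞ (rayIntegral T (c, 1) G) := contDiff_rayIntegral hT _ hGs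
  refine ⟨rayIntegral T (c, 1) G, ⟨hφs, T', hT', fun x _ t ht =>
    rayIntegral_eq_zero hT.le (by simp) hGT ht⟩, fun z hz => ?_⟩
  rw [wave_operator_eq_fderiv c hφs]
  have hev : (fun w => fderiv ℝ (rayIntegral T (c, 1) G) w (c, 1)) =ᶠ[nhds z] fun w => -G w := by
    filter_upwards [(isOpen_lt continuous_const continuous_snd).mem_nhds hz] with w hw
    rw [fderiv_rayIntegral_apply_self hT _ hGs, hGT (w + T • (c, 1)), zero_sub]
    have : 0 < w.2 := hw
    simp only [Prod.snd_add, Prod.smul_snd, smul_eq_mul, mul_one]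
    linarith
  rw [hev.fderiv_eq, fderiv_fun_neg, _root_.neg_apply,
    fderiv_rayIntegral_apply_self hT _ hf, hfT (z + T • (-c, 1))]
  · ring
  · simp only [Prod.snd_add, Prod.smul_snd, smul_eq_mul, mul_one]
    linarith

/-- A very weak solution all of whose traces vanish is zero, by duality with
`exists_isTest_wave_operator_eq`. -/
theorem IsWaveSolution.ae_eq_zero {c a b T : ℝ} {S : TracedFunction} (hT : 0 < T)
    (hS : IsWaveSolution c a b T S)
    (hl : EqOnWindow T S.left 0) (hr : EqOnWindow T S.right 0)
    (hnl : EqOnWindow T S.NLeft 0) (hnr : EqOnWindow T S.NRight 0) :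
    ∀ᵐ z ∂(volume.restrict (cylinder a b T)), S.u z = 0 := by
  have hopen : IsOpen (cylinder a b T) := isOpen_Ioo.prod isOpen_Ioo
  rw [ae_restrict_iff' hopen.measurableSet]
  refine hopen.ae_eq_zero_of_integral_contDiff_smul_eq_zero
    hS.integrable_u.locallyIntegrableOn fun f hf hfc hfs => ?_
  obtain ⟨T', hT', hsupp⟩ := exists_lt_forall_mem_lt (hfc.isCompact.image continuous_snd)
    (T := T) (by rintro _ ⟨z, hz, rfl⟩; exact (hfs hz).2.2)
  have hfT : ∀ z : ℝ × ℝ, T' ≤ z.2 → f z = 0 := fun z hz =>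
    image_eq_zero_of_notMem_tsupport fun h => (hsupp _ (mem_image_of_mem _ h)).not_ge hz
  obtain ⟨φ, hφ, hwave⟩ := exists_isTest_wave_operator_eq c a b hT hT' hf hfT
  have hw := hS.weak φ hφ
  have h1 : ∫ t in Ioo 0 T, (S.left t * dx φ (a, t) - S.right t * dx φ (b, t)) = 0 := by
    apply integral_eq_zero_of_ae
    filter_upwards [hl, hr] with t h1 h2
    simp [h1, h2]
  have h2 : ∫ t in Ioo 0 T, (S.NLeft t * dt φ (a, t) - S.NRight t * dt φ (b, t)) = 0 := by
    apply integral_eq_zero_of_ae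
    filter_upwards [hnl, hnr] with t h1 h2
    simp [h1, h2]
  rw [h1, h2, mul_zero, add_zero] at hw
  rw [← hw, ← setIntegral_eq_integral_of_forall_compl_eq_zero (s := cylinder a b T)]
  · refine setIntegral_congr_fun hopen.measurableSet fun z hz => ?_
    rw [hwave z hz.2.1, smul_eq_mul, mul_comm]
  · intro z hz
    rw [image_eq_zero_of_notMem_tsupport fun h => hz (hfs h), zero_smul]

/-! ### Transport of the boundary waves along characteristics -/

/-- `f = 0` almost everywhere on the part `t < s` of the time window `(0, T)`. -/
def VanishesBefore (T s : ℝ) (f : ℝ → ℝ) : Prop := ∀ᵐ t, t ∈ Ioo 0 T → t < s → f t = 0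

theorem VanishesBefore.mono {T s r : ℝ} {f : ℝ → ℝ} (h : VanishesBefore T s f) (hr : r ≤ s) :
    VanishesBefore T r f := by
  filter_upwards [h] with t ht hw htr using ht hw (htr.trans_le hr)

theorem vanishesBefore_of_nonpos {T s : ℝ} (hs : s ≤ 0) (f : ℝ → ℝ) : VanishesBefore T s f :=
  .of_forall fun _ hw hts => absurd (hw.1.trans hts) hs.not_gt

theorem EqOnWindow.ae {T : ℝ} {f g : ℝ → ℝ} (h : EqOnWindow T f g) :
    ∀ᵐ t, t ∈ Ioo 0 T → f t = g t :=
  (ae_restrict_iff' measurableSet_Ioo).1 h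

theorem EqOnWindow.vanishesBefore {T s : ℝ} {f g : ℝ → ℝ} (h : EqOnWindow T f g)
    (hg : VanishesBefore T s g) : VanishesBefore T s f := by
  filter_upwards [h.ae, hg] with t h1 h2 hw hts
  rw [h1 hw, h2 hw hts]

theorem VanishesBefore.eqOnWindow {T s : ℝ} {f : ℝ → ℝ} (h : VanishesBefore T s f) (hs : T ≤ s) :
    EqOnWindow T f 0 := by
  refine (ae_restrict_iff' measurableSet_Ioo).2 ?_
  filter_upwards [h] with t ht hw using ht hw (hw.2.trans_le hs)

namespace TracedFunction

variable (S : TracedFunction) (c : ℝ)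

/-- Twice the amplitude of the right-going wave at the left end, which leaves that end. By
d'Alembert's formula `u = A(t - x / c) + B(t + x / c)` one has `c ∫₀ᵗ ∂ₓu = B - A` there. -/
def outLeft (t : ℝ) : ℝ := S.left t - c * S.NLeft t

/-- Twice the amplitude of the left-going wave at the left end, which arrives there. -/
def inLeft (t : ℝ) : ℝ := S.left t + c * S.NLeft t

/-- Twice the amplitude of the left-going wave at the right end, which leaves that end. -/
def outRight (t : ℝ) : ℝ := S.right t + c * S.NRight t

/-- Twice the amplitude of the right-going wave at the right end, which arrives there. -/
def inRight (t : ℝ) : ℝ := S.right t - c * S.NRight t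

end TracedFunction

theorem exists_primitive_eq_zero {g : ℝ → ℝ} (hg : ContDiff ℝ ∞ g) {T' : ℝ}
    (hgT : ∀ t, T' ≤ t → g t = 0) :
    ∃ G : ℝ → ℝ, ContDiff ℝ ∞ G ∧ (∀ t, HasDerivAt G (g t) t) ∧ ∀ t, T' ≤ t → G t = 0 := by
  have hd : ∀ t, HasDerivAt (fun r => ∫ y in T'..r, g y) (g t) t := fun t =>
    intervalIntegral.integral_hasDerivAt_right (hg.continuous.intervalIntegrable _ _)
      (hg.continuous.stronglyMeasurableAtFilter _ _) hg.continuous.continuousAt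
  refine ⟨fun r => ∫ y in T'..r, g y, ?_, hd, fun t ht => ?_⟩
  · rw [contDiff_infty_iff_deriv]
    exact ⟨fun t => (hd t).differentiableAt, by rwa [funext fun t => (hd t).deriv]⟩
  · change ∫ y in T'..t, g y = 0
    rw [intervalIntegral.integral_congr (g := fun _ => 0)]
    · simp
    · intro y hy
      rw [uIcc_of_le ht] at hy
      exact hgT y hy.1

theorem IntegrableOn.mul_of_hasCompactSupport {f g : ℝ → ℝ} {s : Set ℝ} (hf : IntegrableOn f s)
    (hg : Continuous g) (hgc : HasCompactSupport g) : IntegrableOn (fun t => f t * g t) s := by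
  obtain ⟨C, hC⟩ := hgc.exists_bound_of_continuous hg
  exact Integrable.mul_bdd hf hg.aestronglyMeasurable (.of_forall hC)

/-- The weak formulation tested with the plane waves `φ(x, t) = G(t + κ x + d)`, `κ = ± 1 / c`,
`G' = g`, which solve the wave equation themselves: the two combinations
`κ u + ∫₀ᵗ ∂ₓu` at the two ends agree up to a shift in time. -/
theorem IsWaveSolution.integral_planeWave {c a b T : ℝ} {S : TracedFunction} (hc : c ≠ 0)
    (hS : IsWaveSolution c a b T S) {κ d : ℝ} (hκ : c ^ 2 * κ ^ 2 = 1) {g : ℝ → ℝ}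
    (hg : ContDiff ℝ ∞ g) (hgc : HasCompactSupport g) {T' : ℝ} (hT' : T' < T)
    (hgT : ∀ x ∈ Icc a b, ∀ t, T' ≤ t → T' ≤ t + κ * x + d)
    (hg0 : ∀ t, T' ≤ t → g t = 0) :
    ∫ t in Ioo 0 T, (κ * S.left t + S.NLeft t) * g (t + (κ * a + d)) =
      ∫ t in Ioo 0 T, (κ * S.right t + S.NRight t) * g (t + (κ * b + d)) := by
  obtain ⟨G, hG, hGd, hG0⟩ := exists_primitive_eq_zero hg hg0
  set φ : ℝ × ℝ → ℝ := fun z => G (z.2 + κ * z.1 + d) with hφ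
  have hdxarg : ∀ z : ℝ × ℝ, HasDerivAt (fun y => z.2 + κ * y + d) κ z.1 := fun z => by
    simpa using (((hasDerivAt_id z.1).const_mul κ).const_add z.2).add_const d
  have hdtarg : ∀ z : ℝ × ℝ, HasDerivAt (fun s => s + κ * z.1 + d) 1 z.2 := fun z =>
    ((hasDerivAt_id z.2).add_const (κ * z.1)).add_const d
  have hgd : ∀ t, HasDerivAt g (deriv g t) t := fun t =>
    (hg.differentiable (by simp) t).hasDerivAt
  have hdx : dx φ = fun z => κ * g (z.2 + κ * z.1 + d) := by
    ext z
    rw [mul_comm]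
    exact ((hGd _).comp z.1 (hdxarg z)).deriv
  have hdt : dt φ = fun z => g (z.2 + κ * z.1 + d) := by
    ext z
    rw [← mul_one (g _)]
    exact ((hGd _).comp z.2 (hdtarg z)).deriv
  have hdxx : ∀ z, dx (dx φ) z = κ ^ 2 * deriv g (z.2 + κ * z.1 + d) := by
    intro z
    rw [hdx, show κ ^ 2 * deriv g (z.2 + κ * z.1 + d) =
      κ * (deriv g (z.2 + κ * z.1 + d) * κ) by ring]
    exact (((hgd _).comp z.1 (hdxarg z)).const_mul κ).deriv
  have hdtt : ∀ z, dt (dt φ) z = deriv g (z.2 + κ * z.1 + d) := by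
    intro z
    rw [hdt, ← mul_one (deriv g _)]
    exact ((hgd _).comp z.2 (hdtarg z)).deriv
  have htest : IsTest a b T φ :=
    ⟨hG.comp (by fun_prop), T', hT', fun x hx t ht => hG0 _ (hgT x hx t ht)⟩
  have hw := hS.weak φ htest
  have hz : ∀ z, S.u z * (dt (dt φ) z - c ^ 2 * dx (dx φ) z) = 0 := fun z => by
    rw [hdxx, hdtt, ← mul_assoc, hκ]
    ring
  simp only [hz, integral_zero] at hw
  rw [hdx, hdt] at hw
  have hcomp : ∀ e : ℝ, HasCompactSupport fun t => g (t + e) := fun e =>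
    hgc.comp_homeomorph (Homeomorph.addRight e)
  have hint : ∀ {f : ℝ → ℝ}, IntegrableOn f (Ioo 0 T) → ∀ e : ℝ,
      IntegrableOn (fun t => f t * g (t + e)) (Ioo 0 T) := fun hf e =>
    IntegrableOn.mul_of_hasCompactSupport hf
      (hg.continuous.comp (continuous_id.add continuous_const)) (hcomp e)
  have hl := hint hS.integrable_left (κ * a + d)
  have hr := hint hS.integrable_right (κ * b + d)
  have hnl := hint hS.integrable_NLeft (κ * a + d)
  have hnr := hint hS.integrable_NRight (κ * b + d)
  have e1 : ∫ t in Ioo 0 T, (κ * S.left t + S.NLeft t) * g (t + (κ * a + d)) =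
      κ * (∫ t in Ioo 0 T, S.left t * g (t + (κ * a + d))) +
        ∫ t in Ioo 0 T, S.NLeft t * g (t + (κ * a + d)) := by
    rw [← integral_const_mul, ← integral_add (hl.const_mul κ) hnl]
    congr 1 with t
    ring
  have e2 : ∫ t in Ioo 0 T, (κ * S.right t + S.NRight t) * g (t + (κ * b + d)) =
      κ * (∫ t in Ioo 0 T, S.right t * g (t + (κ * b + d))) +
        ∫ t in Ioo 0 T, S.NRight t * g (t + (κ * b + d)) := by
    rw [← integral_const_mul, ← integral_add (hr.const_mul κ) hnr]
    congr 1 with t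
    ring
  have e3 : ∫ t in Ioo 0 T, (S.left t * (κ * g (t + κ * a + d)) -
      S.right t * (κ * g (t + κ * b + d))) =
      κ * (∫ t in Ioo 0 T, S.left t * g (t + (κ * a + d))) -
        κ * ∫ t in Ioo 0 T, S.right t * g (t + (κ * b + d)) := by
    rw [← integral_const_mul, ← integral_const_mul,
      ← integral_sub (hl.const_mul κ) (hr.const_mul κ)]
    congr 1 with t
    rw [add_assoc t, add_assoc t]
    ring
  have e4 : ∫ t in Ioo 0 T, (S.NLeft t * g (t + κ * a + d) - S.NRight t * g (t + κ * b + d)) =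
      (∫ t in Ioo 0 T, S.NLeft t * g (t + (κ * a + d))) -
        ∫ t in Ioo 0 T, S.NRight t * g (t + (κ * b + d)) := by
    rw [← integral_sub hnl hnr]
    simp only [add_assoc]
  rw [e3, e4, ← mul_add] at hw
  have := (mul_eq_zero.1 hw.symm).resolve_left (pow_ne_zero 2 hc)
  rw [e1, e2]
  linarith

/-- An integrable function `f` on `(0, T)` that, against every test function `g`, integrates to the
same as `v` against the shifted `g(· + τ)` vanishes before `s + τ` as soon as `v` vanishes
before `s`. -/
theorem vanishesBefore_of_integral_eq_shift {T s τ : ℝ} {f v : ℝ → ℝ}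
    (hf : IntegrableOn f (Ioo 0 T))
    (h : ∀ g : ℝ → ℝ, ContDiff ℝ ∞ g → HasCompactSupport g → ∀ T' < T,
      (∀ t, T' ≤ t → g t = 0) →
      ∫ t in Ioo 0 T, f t * g t = ∫ t in Ioo 0 T, v t * g (t + τ))
    (hv : VanishesBefore T s v) : VanishesBefore T (s + τ) f := by
  have hopen : IsOpen (Ioo 0 (min T (s + τ))) := isOpen_Ioo
  have hae := hopen.ae_eq_zero_of_integral_contDiff_smul_eq_zero (μ := volume) (f := f)
    (hf.mono_set (Ioo_subset_Ioo_right (min_le_left _ _))).locallyIntegrableOn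
    fun g hg hgc hgs => by
      obtain ⟨T', hT', hsupp⟩ := exists_lt_forall_mem_lt hgc.isCompact
        (T := min T (s + τ)) fun t ht => (hgs ht).2
      have hg0 : ∀ t, T' ≤ t → g t = 0 := fun t ht =>
        image_eq_zero_of_notMem_tsupport fun hm => (hsupp t hm).not_ge ht
      have h1 := h g hg hgc T' (hT'.trans_le (min_le_left _ _)) hg0
      have h2 : ∫ t in Ioo 0 T, v t * g (t + τ) = 0 := by
        apply integral_eq_zero_of_ae
        rw [Filter.EventuallyEq, ae_restrict_iff' measurableSet_Ioo]
        filter_upwards [hv] with t ht hw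
        by_cases hts : t < s
        · simp [ht hw hts]
        · have : T' < s + τ := hT'.trans_le (min_le_right _ _)
          simp [hg0 (t + τ) (by linarith [not_lt.1 hts])]
      rw [h2] at h1
      rw [← h1, ← setIntegral_eq_integral_of_forall_compl_eq_zero (s := Ioo 0 T)]
      · simp only [smul_eq_mul, mul_comm]
      · intro t ht
        rw [image_eq_zero_of_notMem_tsupport fun hm =>
          ht ⟨(hgs hm).1, (hgs hm).2.trans_le (min_le_left _ _)⟩, zero_smul]
  filter_upwards [hae] with t ht hw hts using ht ⟨hw.1, lt_min hw.2 hts⟩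

/-- The right-going wave needs the time `(b - a) / c` to cross the interval. -/
theorem IsWaveSolution.inRight_vanishesBefore {c a b T s : ℝ} {S : TracedFunction} (hc : 0 < c)
    (hS : IsWaveSolution c a b T S) (h : VanishesBefore T s (S.outLeft c)) :
    VanishesBefore T (s + (b - a) / c) (S.inRight c) := by
  refine vanishesBefore_of_integral_eq_shift (v := S.outLeft c)
    (hS.integrable_right.sub (hS.integrable_NRight.const_mul c)) (fun g hg hgc T' hT' hg0 => ?_) h
  have := hS.integral_planeWave hc.ne' (κ := -1 / c) (d := b / c) (by field_simp) hg hgc hT'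
    (fun x hx t ht => by
      have : 0 ≤ (b - x) / c := div_nonneg (sub_nonneg.2 hx.2) hc.le
      have e : t + -1 / c * x + b / c = t + (b - x) / c := by ring
      linarith) hg0
  rw [show -1 / c * a + b / c = (b - a) / c by ring, show -1 / c * b + b / c = 0 by ring] at this
  have e1 : ∀ t, S.outLeft c t = -c * (-1 / c * S.left t + S.NLeft t) := fun t => by
    simp only [TracedFunction.outLeft]
    field_simp
    ring
  have e2 : ∀ t, S.inRight c t = -c * (-1 / c * S.right t + S.NRight t) := fun t => by
    simp only [TracedFunction.inRight]
    field_simp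
    ring
  change ∫ t in Ioo 0 T, S.inRight c t * g t = _
  simp only [add_zero] at this
  simp only [e1, e2, mul_assoc (-c), integral_const_mul, this]

/-- The left-going wave needs the time `(b - a) / c` to cross the interval. -/
theorem IsWaveSolution.inLeft_vanishesBefore {c a b T s : ℝ} {S : TracedFunction} (hc : 0 < c)
    (hS : IsWaveSolution c a b T S) (h : VanishesBefore T s (S.outRight c)) :
    VanishesBefore T (s + (b - a) / c) (S.inLeft c) := by
  refine vanishesBefore_of_integral_eq_shift (v := S.outRight c)
    (hS.integrable_left.add (hS.integrable_NLeft.const_mul c)) (fun g hg hgc T' hT' hg0 => ?_) h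
  have := hS.integral_planeWave hc.ne' (κ := 1 / c) (d := -a / c) (by field_simp) hg hgc hT'
    (fun x hx t ht => by
      have : 0 ≤ (x - a) / c := div_nonneg (sub_nonneg.2 hx.1) hc.le
      have e : t + 1 / c * x + -a / c = t + (x - a) / c := by ring
      linarith) hg0
  rw [show 1 / c * b + -a / c = (b - a) / c by ring, show 1 / c * a + -a / c = 0 by ring] at this
  have e1 : ∀ t, S.inLeft c t = c * (1 / c * S.left t + S.NLeft t) := fun t => by
    simp only [TracedFunction.inLeft]
    field_simp
  have e2 : ∀ t, S.outRight c t = c * (1 / c * S.right t + S.NRight t) := fun t => by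
    simp only [TracedFunction.outRight]
    field_simp
  change ∫ t in Ioo 0 T, S.inLeft c t * g t = _
  simp only [add_zero] at this
  simp only [e1, e2, mul_assoc c, integral_const_mul, this]

/-- Causality. If before the time `s` both ends reflect (a wave leaves an end only where one arrives
there, as under homogeneous Dirichlet or Neumann conditions), then no wave arrives at either end
before the time `s + (b - a) / c`: whatever arrives left the opposite end one crossing time
earlier, and so on back to `t = 0`. -/
theorem IsWaveSolution.incoming_vanishesBefore {c a b T s : ℝ} {S : TracedFunction} (hc : 0 < c)
    (hab : a < b) (hS : IsWaveSolution c a b T S)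
    (hl : ∀ᵐ t, t ∈ Ioo 0 T → t < s → S.inLeft c t = 0 → S.outLeft c t = 0)
    (hr : ∀ᵐ t, t ∈ Ioo 0 T → t < s → S.inRight c t = 0 → S.outRight c t = 0) :
    VanishesBefore T (s + (b - a) / c) (S.inLeft c) ∧
      VanishesBefore T (s + (b - a) / c) (S.inRight c) := by
  have hτ : 0 < (b - a) / c := div_pos (sub_pos.2 hab) hc
  have key : ∀ j : ℕ, VanishesBefore T (min s (j * ((b - a) / c)) + (b - a) / c) (S.inLeft c) ∧
      VanishesBefore T (min s (j * ((b - a) / c)) + (b - a) / c) (S.inRight c) := by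
    intro j
    induction j with
    | zero =>
      exact ⟨hS.inLeft_vanishesBefore hc (vanishesBefore_of_nonpos (by simp) _),
        hS.inRight_vanishesBefore hc (vanishesBefore_of_nonpos (by simp) _)⟩
    | succ j ih =>
      have hle : min s ((j + 1 : ℕ) * ((b - a) / c)) ≤
          min s (j * ((b - a) / c)) + (b - a) / c := by
        rw [min_add_add_right _ _ _ |>.symm]
        refine min_le_min (by linarith) (by push_cast; linarith)
      refine ⟨hS.inLeft_vanishesBefore hc ?_, hS.inRight_vanishesBefore hc ?_⟩
      · filter_upwards [hr, ih.2.mono hle] with t h1 h2 hw ht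
        exact h1 hw (ht.trans_le (min_le_left _ _)) (h2 hw ht)
      · filter_upwards [hl, ih.1.mono hle] with t h1 h2 hw ht
        exact h1 hw (ht.trans_le (min_le_left _ _)) (h2 hw ht)
  obtain ⟨j, hj⟩ := exists_nat_ge (s / ((b - a) / c))
  have := key j
  rwa [min_eq_left ((div_le_iff₀ hτ).1 hj)] at this

/-! ### One iteration of the algorithm -/

/-- All four traces of `S` vanish before the time `s`. -/
structure TracesVanishBefore (T s : ℝ) (S : TracedFunction) : Prop where
  left : VanishesBefore T s S.left
  right : VanishesBefore T s S.right
  NLeft : VanishesBefore T s S.NLeft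
  NRight : VanishesBefore T s S.NRight

theorem IsWaveSolution.vanishesBefore_of_homogeneous {c a b T s : ℝ} {S : TracedFunction}
    (hc : 0 < c) (hab : a < b) (hS : IsWaveSolution c a b T S)
    (hl : VanishesBefore T s S.left ∨ VanishesBefore T s S.NLeft)
    (hr : VanishesBefore T s S.right ∨ VanishesBefore T s S.NRight) :
    TracesVanishBefore T s S ∧ VanishesBefore T (s + (b - a) / c) (S.inLeft c) ∧
      VanishesBefore T (s + (b - a) / c) (S.inRight c) := by
  have hl' : ∀ᵐ t, t ∈ Ioo 0 T → t < s → S.left t = 0 ∨ S.NLeft t = 0 := by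
    rcases hl with h | h <;> filter_upwards [h] with t ht hw hts <;> simp [ht hw hts]
  have hr' : ∀ᵐ t, t ∈ Ioo 0 T → t < s → S.right t = 0 ∨ S.NRight t = 0 := by
    rcases hr with h | h <;> filter_upwards [h] with t ht hw hts <;> simp [ht hw hts]
  have hin := hS.incoming_vanishesBefore (s := s) hc hab
    (by
      filter_upwards [hl'] with t ht hw hts h0
      simp only [TracedFunction.inLeft, TracedFunction.outLeft] at h0 ⊢
      rcases ht hw hts with h | h <;> rw [h] at h0 ⊢ <;> linarith)
    (by
      filter_upwards [hr'] with t ht hw hts h0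
      simp only [TracedFunction.inRight, TracedFunction.outRight] at h0 ⊢
      rcases ht hw hts with h | h <;> rw [h] at h0 ⊢ <;> linarith)
  have hle : s ≤ s + (b - a) / c := by
    have := div_pos (sub_pos.2 hab) hc
    linarith
  have hL : ∀ᵐ t, t ∈ Ioo 0 T → t < s → S.left t = 0 ∧ S.NLeft t = 0 := by
    filter_upwards [hl', hin.1.mono hle] with t ht hi hw hts
    have h0 := hi hw hts
    simp only [TracedFunction.inLeft] at h0
    rcases ht hw hts with h | h <;> simp_all [hc.ne']
  have hR : ∀ᵐ t, t ∈ Ioo 0 T → t < s → S.right t = 0 ∧ S.NRight t = 0 := by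
    filter_upwards [hr', hin.2.mono hle] with t ht hi hw hts
    have h0 := hi hw hts
    simp only [TracedFunction.inRight] at h0
    rcases ht hw hts with h | h <;> simp_all [hc.ne']
  refine ⟨⟨?_, ?_, ?_, ?_⟩, hin⟩
  · filter_upwards [hL] with t ht hw hts using (ht hw hts).1
  · filter_upwards [hR] with t ht hw hts using (ht hw hts).1
  · filter_upwards [hL] with t ht hw hts using (ht hw hts).2
  · filter_upwards [hR] with t ht hw hts using (ht hw hts).2

theorem hmin_le {m : ℕ} (x : ℕ → ℝ) {i : ℕ} (h1 : 1 ≤ i) (h2 : i ≤ 2 * m + 1) :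
    hmin m x ≤ x i - x (i - 1) :=
  Finset.inf'_le (fun i => x i - x (i - 1)) (Finset.mem_Icc.2 ⟨h1, h2⟩)

variable {m : ℕ} {x : ℕ → ℝ} {L c T θ : ℝ} {g W : ℕ → ℕ → ℝ → ℝ} {S : ℕ → ℕ → TracedFunction}

/-- If the interface functions of one iteration vanish before `s`, so do all traces of the subdomain
solutions of the next iteration; the homogeneous conditions propagate outwards from the middle
subdomain. The waves that arrive at the interfaces even vanish before `s` plus the smallest
crossing time. -/
theorem IsDNWR.subdomain_vanishesBefore (hS : IsDNWR m x c T θ g W S) (hx : IsPartition L m x)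
    (hc : 0 < c) {n : ℕ} {s : ℝ} (hg : ∀ i ≤ 2 * m + 1, VanishesBefore T s (g n i)) {i : ℕ}
    (h1 : 1 ≤ i) (h2 : i ≤ 2 * m + 1) :
    TracesVanishBefore T s (S (n + 1) i) ∧
      VanishesBefore T (s + hmin m x / c) ((S (n + 1) i).inLeft c) ∧
      VanishesBefore T (s + hmin m x / c) ((S (n + 1) i).inRight c) := by
  have hn : 1 ≤ n + 1 := by omega
  have base : ∀ i, 1 ≤ i → i ≤ 2 * m + 1 →
      (VanishesBefore T s (S (n + 1) i).left ∨ VanishesBefore T s (S (n + 1) i).NLeft) →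
      (VanishesBefore T s (S (n + 1) i).right ∨ VanishesBefore T s (S (n + 1) i).NRight) →
      TracesVanishBefore T s (S (n + 1) i) ∧
      VanishesBefore T (s + hmin m x / c) ((S (n + 1) i).inLeft c) ∧
      VanishesBefore T (s + hmin m x / c) ((S (n + 1) i).inRight c) := by
    intro i h1 h2 hl hr
    have h := (hS.wave (n + 1) i hn h1 h2).vanishesBefore_of_homogeneous hc
      (hx.2.2 i (Finset.mem_Icc.2 ⟨h1, h2⟩)) hl hr
    have hle : s + hmin m x / c ≤ s + (x i - x (i - 1)) / c := by
      gcongr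
      exact hmin_le x h1 h2
    exact ⟨h.1, h.2.1.mono hle, h.2.2.mono hle⟩
  have mid := base (m + 1) (by omega) (by omega)
    (.inl ((hS.mid_left (n + 1) hn).vanishesBefore (hg m (by omega))))
    (.inl ((hS.mid_right (n + 1) hn).vanishesBefore (hg (m + 1) (by omega))))
  rcases le_total i (m + 1) with hi | hi
  · induction hi using Nat.decreasingInduction with
    | self => exact mid
    | of_succ i hi ih =>
      have him : i ≤ m := by omega
      refine base i h1 h2
        (.inl ((hS.lower_dirichlet (n + 1) i hn h1 him).vanishesBefore (hg (i - 1) (by omega))))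
        (.inr ((hS.lower_neumann (n + 1) i hn h1 him).vanishesBefore
          ((hS.lower_flux (n + 1) i hn h1 him).vanishesBefore ?_)))
      exact (ih (by omega) (by omega)).1.NLeft
  · induction i, hi using Nat.le_induction with
    | base => exact mid
    | succ i hi ih =>
      have hNR := (ih (by omega) (by omega)).1.NRight
      have hW := (hS.upper_flux (n + 1) i hn hi (by omega)).vanishesBefore (s := s) (by
        filter_upwards [hNR] with t ht hw hts
        simp [ht hw hts])
      have hNL := (hS.upper_neumann (n + 1) (i + 1) hn (by omega) h2).vanishesBefore hW
      refine base (i + 1) h1 h2 (.inr ?_)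
        (.inl ((hS.upper_dirichlet (n + 1) (i + 1) hn (by omega) h2).vanishesBefore
          (hg (i + 1) h2)))
      filter_upwards [hNL] with t ht hw hts
      simpa using ht hw hts

/-- For `θ = 1/2` the new interface function is the mean of the one-sided traces. The Neumann
traces of the two sides agree, so it is a sum of waves that arrive at the interface: the terms that
leave it cancel. -/
theorem IsDNWR.interface_eq_incoming (hS : IsDNWR m x c T (1 / 2) g W S) {n i : ℕ} (h1 : 1 ≤ i)
    (h2 : i ≤ 2 * m) :
    ∀ᵐ t, t ∈ Ioo 0 T →
      g (n + 1) i t = ((S (n + 1) i).inRight c t + (S (n + 1) (i + 1)).inLeft c t) / 2 := by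
  have hn : 1 ≤ n + 1 := by omega
  simp only [TracedFunction.inRight, TracedFunction.inLeft]
  rcases le_or_gt i m with hi | hi
  · have hleft : EqOnWindow T (S (n + 1) (i + 1)).left (g n i) := by
      rcases hi.eq_or_lt with rfl | hlt
      · exact hS.mid_left (n + 1) hn
      · exact hS.lower_dirichlet (n + 1) (i + 1) hn (by omega) hlt
    filter_upwards [hleft.ae, (hS.lower_update (n + 1) i hn h1 hi).ae,
      (hS.lower_flux (n + 1) i hn h1 hi).ae, (hS.lower_neumann (n + 1) i hn h1 hi).ae]
      with t e1 e2 e3 e4 hw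
    rw [e2 hw, e4 hw, e3 hw, e1 hw, Nat.add_sub_cancel]
    ring
  · have hright : EqOnWindow T (S (n + 1) i).right (g n i) := by
      rcases (Nat.succ_le_of_lt hi).eq_or_lt with rfl | hlt
      · exact hS.mid_right (n + 1) hn
      · exact hS.upper_dirichlet (n + 1) i hn hlt (by omega)
    filter_upwards [hright.ae, (hS.upper_update (n + 1) i hn hi h2).ae,
      (hS.upper_flux (n + 1) i hn hi h2).ae,
      (hS.upper_neumann (n + 1) (i + 1) hn (by omega) (by omega)).ae]
      with t e1 e2 e3 e4 hw
    have h3 := e3 hw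
    have h4 := e4 hw
    rw [Nat.add_sub_cancel, h3] at h4
    simp only [Pi.neg_apply, neg_inj] at h4
    rw [e2 hw, e1 hw, h4, Nat.add_sub_cancel]
    ring

/-- Each iteration extends the initial time interval on which the interface errors vanish by the
smallest crossing time `h_min / c`. -/
theorem IsDNWR.interface_vanishesBefore (hS : IsDNWR m x c T (1 / 2) g W S)
    (hx : IsPartition L m x) (hc : 0 < c) (n : ℕ) :
    ∀ i ≤ 2 * m + 1, VanishesBefore T (n * (hmin m x / c)) (g n i) := by
  induction n with
  | zero => exact fun i _ => vanishesBefore_of_nonpos (by simp) _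
  | succ n ih =>
    intro i hi
    rcases Nat.eq_zero_or_pos i with rfl | h1
    · exact (hS.bdry_left (n + 1)).vanishesBefore (.of_forall fun _ _ _ => rfl)
    rcases hi.eq_or_lt with rfl | h2
    · exact (hS.bdry_right (n + 1)).vanishesBefore (.of_forall fun _ _ _ => rfl)
    have hs : ((n + 1 : ℕ) : ℝ) * (hmin m x / c) = n * (hmin m x / c) + hmin m x / c := by
      push_cast
      ring
    rw [hs]
    filter_upwards [hS.interface_eq_incoming (n := n) h1 (by omega),
      (hS.subdomain_vanishesBefore hx hc ih h1 hi).2.2,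
      (hS.subdomain_vanishesBefore hx hc ih (i := i + 1) (by omega) (by omega)).2.1]
      with t e1 e2 e3 hw hts
    rw [e1 hw, e2 hw hts, e3 hw hts]
    simp

end DNWR

/-- Convergence of DNWR for `2m + 1` subdomains with `θ = 1/2`: if `T / k ≤ h_min / c`, then the
interface errors vanish after iteration `k` and the subdomain errors from iteration `k + 1` on. -/
theorem theorem3p1 (m : ℕ) (x : ℕ → ℝ) (L c T : ℝ) (hx : DNWR.IsPartition L m x)
    (hc : 0 < c) (hT : 0 < T)
    (g W : ℕ → ℕ → ℝ → ℝ) (S : ℕ → ℕ → DNWR.TracedFunction)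
    (hS : DNWR.IsDNWR m x c T (1 / 2) g W S)
    (k : ℕ) (hk : 1 ≤ k) (hTk : T / k ≤ DNWR.hmin m x / c) :
    (∀ n, k ≤ n → ∀ i, 1 ≤ i → i ≤ 2 * m →
      ∀ᵐ t ∂(MeasureTheory.volume.restrict (Set.Ioo 0 T)), g n i t = 0) ∧
    (∀ n, k + 1 ≤ n → ∀ i, 1 ≤ i → i ≤ 2 * m + 1 →
      ∀ᵐ z ∂(MeasureTheory.volume.restrict (DNWR.cylinder (x (i - 1)) (x i) T)),
        (S n i).u z = 0) := by
  have hk0 : (0 : ℝ) < k := by exact_mod_cast hk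
  have hTle : ∀ n, k ≤ n → T ≤ n * (DNWR.hmin m x / c) := fun n hn =>
    calc T = k * (T / k) := by field_simp
      _ ≤ n * (DNWR.hmin m x / c) := by gcongr
  refine ⟨fun n hn i _ h2 =>
    (hS.interface_vanishesBefore hx hc n i (by omega)).eqOnWindow (hTle n hn),
    fun n hn i h1 h2 => ?_⟩
  obtain ⟨n, rfl⟩ : ∃ l, n = l + 1 := ⟨n - 1, by omega⟩
  have htr := (hS.subdomain_vanishesBefore hx hc (hS.interface_vanishesBefore hx hc n) h1 h2).1
  have hTn := hTle n (by omega)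
  exact (hS.wave (n + 1) i (by omega) h1 h2).ae_eq_zero hT (htr.left.eqOnWindow hTn)
    (htr.right.eqOnWindow hTn) (htr.NLeft.eqOnWindow hTn) (htr.NRight.eqOnWindow hTn)
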